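/- Let $p$ be an odd prime, let $\chi$ be a primitive Dirichlet character of odd conductor $d$ with values in $\mathbb{C}_p$, and let $F$ be an odd positive integer divisible by both $p$ and $d$. Let $|\cdot|_p$ be the absolute value of $\mathbb{C}_p$ with $|p|_p=1/p$. Let $\omega$ be the Teichmüller character (of conductor $p$), put $\langle x\rangle=x/\omega(x)$ for $x\in\mathbb{Z}_p^\times$, and for $n\in\mathbb{Z}$ let $\chi_n$ be the primitive Dirichlet character inducing the product $\chi\omega^{-n}$. Define the Euler numbers $E_k$ and, for a primitive Dirichlet character $\psi$ of odd conductor $m$, the generalized Euler numbers $E_{k,\psi}$ by $$\frac{2}{e^t+1}=\sum_{k\ge0}E_k\frac{t^k}{k!},\qquad \frac{2\sum_{a=1}^{m}(-1)^a\psi(a)e^{at}}{e^{mt}+1}=\sum_{k\ge0}E_{k,\psi}\frac{t^k}{k!}.$$ Let $X=\varprojlim_N\mathbb{Z}/dp^N\mathbb{Z}$, let $X^*\subset X$ be the union of the classes $a+dp\mathbb{Z}_p=\{x\in X: x\equiv a \pmod{dp}\}$ over $0<a<dp$ with $(a,p)=1$, and write $$\int_{X^*}f(x)\,d\mu_{-1}(x)=\lim_{N\to\infty}\sum_{\substack{0\le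 x<dp^N\\ x\in X^*}}f(x)(-1)^x .$$ For $x\in X$, $\chi_n(x)$ is evaluated through the residue of $x$ modulo $dp$, and $x^n$, $\omega(x)$, $\langle x\rangle$ are evaluated at the image of $x$ in $\mathbb{Z}_p$. Put $\langle x\rangle^{s}=\sum_{k\ge0}\binom{s}{k}(\langle x\rangle-1)^k$ and $$l_p(s,\chi)=\sum_{\substack{a=1\\ p\nmid a}}^{F}(-1)^a\chi(a)\langle a\rangle^{-s}\sum_{k=0}^\infty\binom{-s}{k}\Big(\frac Fa\Big)^kE_k .$$ Then: (a) All these series converge for $s$ in $D=\{s\in\mathbb{C}_p: |s|_p<p^{1-\frac1{p-1}}\}$ (for $\langle x\rangle^{-s}$, with every $x\in\mathbb{Z}_p^\times$), and $l_p(s,\chi)$ is analytic in $D$, that is, it is given on $D$ by a single power series in $s$ converging on $D$. (b) For every integer $n\ge1$, $\;l_p(-n,\chi)=E_{n,\chi_n}-p^n\chi_n(p)E_{n,\chi_n}$. (c) For every $s\in D$ and every $n\in\mathbb{Z}$, $$l_p(s,\chi)=\int_{X^*}\chi_n(x)\,x^{-s}\,d\mu_{-1}(x),$$ where $x^{-s}$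 denotes the branch $\omega(x)^n\langle x\rangle^{-s}$ of the $p$-adic power, which equals $x^n$ at $s=-n$ (so the integrand is $\chi(x)\langle x\rangle^{-s}$). In particular, for every integer $n\ge1$, $$l_p(-n,\chi)=\int_{X^*}\chi_n(x)\,x^n\,d\mu_{-1}(x),$$ and all the limits defining these integrals exist. -/

import Mathlib

open Filter Topology

noncomputable section

namespace PadicEulerL

/-! ### Euler numbers -/

/-- The Euler number `E_n`, defined by `2 / (e ^ t + 1) = ∑ E_n t ^ n / n!` in `ℚ⟦t⟧`. -/
def eulerNumber (n : ℕ) : ℚ :=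
  (n.factorial : ℚ) *
    PowerSeries.coeff n (PowerSeries.C (2 : ℚ) * (PowerSeries.exp ℚ + 1)⁻¹)

/-- The exponential power series `e ^ (a t)` over a field of characteristic zero. -/
def expSeries {K : Type*} [Field K] [CharZero K] (a : K) : PowerSeries K :=
  PowerSeries.mk fun n => a ^ n / (n.factorial : K)

/-- The generalized Euler number `E_{n,χ}` of a Dirichlet character of level `d` (used for primitive
characters, so that `d` is the conductor), defined by
`2 (∑_{a=1}^{d} (-1) ^ a χ(a) e ^ (a t)) / (e ^ (d t) + 1) = ∑ E_{n,χ} t ^ n / n!`. -/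
def genEulerNumber {K : Type*} [Field K] [CharZero K] {d : ℕ} (χ : DirichletCharacter K d)
    (n : ℕ) : K :=
  (n.factorial : K) *
    PowerSeries.coeff n
      (PowerSeries.C (2 : K) *
        (∑ a ∈ Finset.Icc 1 d, PowerSeries.C ((-1) ^ a * χ (a : ZMod d)) * expSeries (a : K)) *
        (expSeries (d : K) + 1)⁻¹)

/-! ### The space `X` -/

/-- `X = lim ℤ / d p ^ N ℤ`, as a subring of the product. -/
def XSpace (p d : ℕ) : Subring (∀ N : ℕ, ZMod (d * p ^ N)) where
  carrier := {x | ∀ M N : ℕ, ∀ h : M ≤ N,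
    ZMod.castHom (mul_dvd_mul_left d (pow_dvd_pow p h)) (ZMod (d * p ^ M)) (x N) = x M}
  mul_mem' := by
    intro x y hx hy M N h
    rw [Pi.mul_apply, map_mul, hx M N h, hy M N h, Pi.mul_apply]
  one_mem' := by
    intro M N h
    rw [Pi.one_apply, map_one, Pi.one_apply]
  add_mem' := by
    intro x y hx hy M N h
    rw [Pi.add_apply, map_add, hx M N h, hy M N h, Pi.add_apply]
  zero_mem' := by
    intro M N h
    rw [Pi.zero_apply, map_zero, Pi.zero_apply]
  neg_mem' := by
    intro x hx M N h
    rw [Pi.neg_apply, map_neg, hx M N h, Pi.neg_apply]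

/-- The projection `X → ℤ / p ^ N ℤ`. -/
def XSpace.toZModPow (p d N : ℕ) : XSpace p d →+* ZMod (p ^ N) :=
  (ZMod.castHom (dvd_mul_left (p ^ N) d) (ZMod (p ^ N))).comp
    ((Pi.evalRingHom (fun N : ℕ => ZMod (d * p ^ N)) N).comp (XSpace p d).subtype)

theorem XSpace.toZModPow_compat (p d M N : ℕ) (h : M ≤ N) :
    (ZMod.castHom (pow_dvd_pow p h) (ZMod (p ^ M))).comp (XSpace.toZModPow p d N) =
      XSpace.toZModPow p d M := by
  ext x
  have hx := x.2 M N h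
  simp only [XSpace.toZModPow, RingHom.comp_apply, Subring.subtype_apply, Pi.evalRingHom_apply]
  rw [← hx]
  simp only [← RingHom.comp_apply]
  congr 1
  exact RingHom.ext_zmod _ _

/-! ### Teichmüller character and powers -/

/-- The generalized binomial coefficient `s (s - 1) ⋯ (s - k + 1) / k!`. -/
def binom {K : Type*} [Field K] (s : K) (k : ℕ) : K :=
  (∏ i ∈ Finset.range k, (s - (i : K))) / (k.factorial : K)

variable (p : ℕ) [Fact p.Prime]

/-- The embedding of `ℤ_p` into `ℂ_p`. -/
def toCp : ℤ_[p] →+* ℂ_[p] :=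
  (algebraMap ℚ_[p] ℂ_[p]).comp PadicInt.Coe.ringHom

/-- The Teichmüller character with values in `ℤ_p`. -/
def teichmullerInt : DirichletCharacter ℤ_[p] p where
  toMonoidHom := (WittVector.toPadicInt p).toMonoidHom.comp (WittVector.teichmuller p)
  map_nonunit' := by
    intro a ha
    have h0 : a = 0 := by
      by_contra h
      exact ha (isUnit_iff_ne_zero.mpr h)
    subst h0
    change WittVector.toPadicInt p (WittVector.teichmuller p (0 : ZMod p)) = 0
    rw [WittVector.teichmuller_zero, map_zero]

/-- The Teichmüller character `ω`, a Dirichlet character of conductor `p` with values in `ℂ_p`. -/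
def teichmullerChar : DirichletCharacter ℂ_[p] p :=
  (teichmullerInt p).ringHomComp (toCp p)

variable {p}

/-- `χ_n = χ ω ^ (-n)`, the product being the primitive Dirichlet character that induces
the pointwise product. Its level is its conductor. -/
def twist {d : ℕ} (χ : DirichletCharacter ℂ_[p] d) (n : ℤ) :
    DirichletCharacter ℂ_[p]
      (DirichletCharacter.mul χ (teichmullerChar p ^ (-n))).conductor :=
  DirichletCharacter.primitive_mul χ (teichmullerChar p ^ (-n))

/-- `ω(x)` for `x ∈ ℤ_p`, as an element of `ℂ_p`. -/
def omega (x : ℤ_[p]) : ℂ_[p] := teichmullerChar p (PadicInt.toZMod x)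

/-- `⟨x⟩ = x / ω(x)` for `x ∈ ℤ_p`, as an element of `ℂ_p`. It is a principal unit when `x` is a
unit. -/
def angle (x : ℤ_[p]) : ℂ_[p] := toCp p x / omega x

/-- `u ^ s` for a principal unit `u`, by the binomial series `∑ binom(s, k) (u - 1) ^ k`. -/
def unitPow (u s : ℂ_[p]) : ℂ_[p] := ∑' k : ℕ, binom s k * (u - 1) ^ k

/-- The `n`-th branch `ω(x) ^ n ⟨x⟩ ^ s` of the `p`-adic power `x ^ s`, for a unit `x` of `ℤ_p`.
It takes the value `x ^ n` at `s = n`. -/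
def branchPow (n : ℤ) (x : ℤ_[p]) (s : ℂ_[p]) : ℂ_[p] :=
  omega x ^ n * unitPow (angle x) s

/-! ### The `p`-adic `l`-function -/

variable (p) in
/-- The radius `p ^ (1 - 1 / (p - 1))`. -/
def discRadius : ℝ := (p : ℝ) ^ (1 - 1 / ((p : ℝ) - 1))

variable (p) in
/-- The disc `D = {s ∈ ℂ_p : |s| < p ^ (1 - 1 / (p - 1))}`. -/
def disc : Set ℂ_[p] := {s | ‖s‖ < discRadius p}

/-- The `k`-th term of the inner series, `binom(-s, k) (F / a) ^ k E_k`. -/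
def innerTerm (F a : ℕ) (s : ℂ_[p]) (k : ℕ) : ℂ_[p] :=
  binom (-s) k * ((F : ℂ_[p]) / (a : ℂ_[p])) ^ k * (eulerNumber k : ℂ_[p])

/-- `l_p(s, χ) = ∑_{1 ≤ a ≤ F, p ∤ a} (-1) ^ a χ(a) ⟨a⟩ ^ (-s) ∑_k binom(-s, k) (F / a) ^ k E_k`. -/
def padicL {d : ℕ} (χ : DirichletCharacter ℂ_[p] d) (F : ℕ) (s : ℂ_[p]) : ℂ_[p] :=
  ∑ a ∈ (Finset.Icc 1 F).filter (fun a => ¬ p ∣ a),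
    (-1) ^ a * χ (a : ZMod d) * unitPow (angle (a : ℤ_[p])) (-s) * ∑' k : ℕ, innerTerm F a s k

/-! ### The fermionic integral -/

variable (p)

/-- The projection `X → ℤ_p`. -/
def XSpace.toPadicInt (d : ℕ) : XSpace p d →+* ℤ_[p] :=
  PadicInt.lift (XSpace.toZModPow_compat p d)

variable {p}

/-- The set `a + d p ^ N ℤ_p = {x ∈ X : x ≡ a mod d p ^ N}`. -/
def XSpace.coset (d a N : ℕ) : Set (XSpace p d) := {x | x.1 N = (a : ZMod (d * p ^ N))}

variable (p) in
/-- `X^*`, the union of the sets `a + d p ℤ_p` over `0 < a < d p` with `(a, p) = 1`. -/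
def XSpace.star (d : ℕ) : Set (XSpace p d) :=
  ⋃ a ∈ {a : ℕ | 0 < a ∧ a < d * p ∧ a.Coprime p}, XSpace.coset d a 1

/-- The function on `X` that a Dirichlet character of level `m ∣ d p` induces, through
`X → ℤ / d p ℤ → ℤ / m ℤ`. -/
def XSpace.evalChar {d m : ℕ} (ψ : DirichletCharacter ℂ_[p] m) (x : XSpace p d) : ℂ_[p] :=
  ψ ((x.1 1).cast : ZMod m)

/-- `∫_X f(x) dμ_{-1}(x) = I`, that is, `lim_N ∑_{0 ≤ x < d p ^ N} f(x) (-1) ^ x = I`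
(for odd `d p ^ N` the normalizing factor `[d p ^ N]_{-1}` is `1`). -/
def HasFermionicIntegral {d : ℕ} (f : XSpace p d → ℂ_[p]) (I : ℂ_[p]) : Prop :=
  Tendsto (fun N : ℕ => ∑ x ∈ Finset.range (d * p ^ N), f (x : XSpace p d) * (-1) ^ x)
    atTop (𝓝 I)

/-- `∫_A f(x) dμ_{-1}(x) = I`, the integral over `X` of `f` times the indicator of `A`. -/
def HasFermionicIntegralOn {d : ℕ} (A : Set (XSpace p d)) (f : XSpace p d → ℂ_[p])
    (I : ℂ_[p]) : Prop :=
  HasFermionicIntegral (A.indicator f) I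

end PadicEulerL

end

open PadicEulerL

namespace PadicEulerL

/-! ### Norms -/

section Norms

variable {p : ℕ} [Fact p.Prime]

/-! Everything reduces to the Euler numbers being `p`-integral for odd `p`, and to an identity
principle on the disc.

Convergence: `binom s k` is a polynomial in `s` with integer coefficients divided by `k!`.
Legendre's formula bounds `1 / |k!|` by `p ^ (k / (p - 1))`, so against coefficients of size at most
`p ^ (-k)` the double series in `k` and in powers of `s` converges absolutely on the disc and can be
rearranged. This covers both `⟨a⟩ ^ (-s)` and the inner series, because `p ∣ F` and `|E_k| ≤ 1`.

Special values: at `s = -n` the series terminate. The powers of `ω` cancel against the twist, and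
what remains is the sum over `a` prime to `p` in the formula for `E_{n,χ_n}` with modulus `F`; the
multiples of `p` account for the Euler factor (`padicL_neg_natCast`).

Independence of `F`: positive integers accumulate at `0`, so power series agreeing at them coincide
on the disc (`IsPowerSeriesOn.eq_of_eq_natCast`). The values in (b) do not involve `F`, hence
neither does the function, and `F = d p` may be assumed.

Integral: write `x = a + d p j` and expand `⟨x⟩ ^ (-s)` as `⟨a⟩ ^ (-s) (1 + d p j / a) ^ (-s)`. The
alternating power sums over `j < p ^ N` tend to `E_k` with error at most `|p ^ N|`, uniformly in
`k`, so the limit passes through the binomial series and yields the inner series. -/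

theorem norm_toCp (x : ℤ_[p]) : ‖toCp p x‖ = ‖x‖ :=
  PadicComplex.norm_extends' p (x : ℚ_[p])

theorem norm_natCast_eq (n : ℕ) : ‖(n : ℂ_[p])‖ = ‖(n : ℚ_[p])‖ := by
  rw [← PadicComplex.norm_extends' p (n : ℚ_[p])]
  simp

theorem norm_natCast_le_one (n : ℕ) : ‖(n : ℂ_[p])‖ ≤ 1 := by
  rw [norm_natCast_eq]
  exact_mod_cast Padic.norm_int_le_one (p := p) n

theorem norm_natCast_eq_one {n : ℕ} (hn : ¬ p ∣ n) : ‖(n : ℂ_[p])‖ = 1 := by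
  rw [norm_natCast_eq, Padic.norm_natCast_eq_one_iff]
  exact ((Fact.out : p.Prime).coprime_iff_not_dvd.mpr hn)

theorem norm_natCast_prime : ‖(p : ℂ_[p])‖ = (p : ℝ)⁻¹ := by
  rw [norm_natCast_eq, Padic.norm_p]

theorem norm_natCast_le_of_dvd {n : ℕ} (hn : p ∣ n) : ‖(n : ℂ_[p])‖ ≤ (p : ℝ)⁻¹ := by
  obtain ⟨m, rfl⟩ := hn
  rw [Nat.cast_mul, norm_mul, norm_natCast_prime]
  exact mul_le_of_le_one_right (by positivity) (norm_natCast_le_one m)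

theorem norm_div_natCast_le {F a : ℕ} (hF : p ∣ F) (ha : ¬ p ∣ a) :
    ‖(F : ℂ_[p]) / (a : ℂ_[p])‖ ≤ (p : ℝ)⁻¹ := by
  rw [norm_div, norm_natCast_eq_one ha, div_one]
  exact norm_natCast_le_of_dvd hF

/-! ### The Teichmüller character -/

/-- Every `x` differs from a natural number by a multiple of `p`, which pins down its image. This
identifies reduction mod `p` with the constant coefficient on Witt vectors. -/
theorem ringHom_eq_toZMod (f : ℤ_[p] →+* ZMod p) : f = PadicInt.toZMod := by
  ext x
  have h := PadicInt.sub_zmodRepr_mem x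
  rw [PadicInt.maximalIdeal_eq_span_p, Ideal.mem_span_singleton] at h
  obtain ⟨y, hy⟩ := h
  have key : ∀ g : ℤ_[p] →+* ZMod p, g x = (x.zmodRepr : ZMod p) := fun g => by
    have h := congrArg g (eq_add_of_sub_eq hy)
    rw [map_add, map_mul, map_natCast, map_natCast, CharP.cast_eq_zero, zero_mul, zero_add] at h
    exact h
  rw [key f, key PadicInt.toZMod]

theorem toZMod_teichmullerInt (a : ZMod p) : PadicInt.toZMod (teichmullerInt p a) = a := by
  have h := congrArg (fun f : ℤ_[p] →+* ZMod p => f (teichmullerInt p a))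
    (ringHom_eq_toZMod (WittVector.constantCoeff.comp (WittVector.fromPadicInt p)))
  rw [← h]
  change WittVector.constantCoeff (WittVector.fromPadicInt p
    (WittVector.toPadicInt p (WittVector.teichmuller p a))) = a
  rw [← RingHom.comp_apply (WittVector.fromPadicInt p),
    WittVector.fromPadicInt_comp_toPadicInt_ext]
  simp

theorem norm_sub_teichmullerInt_le (x : ℤ_[p]) :
    ‖x - teichmullerInt p (PadicInt.toZMod x)‖ ≤ (p : ℝ)⁻¹ := by
  have h : x - teichmullerInt p (PadicInt.toZMod x) ∈ RingHom.ker (PadicInt.toZMod (p := p)) := by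
    rw [RingHom.mem_ker, map_sub, toZMod_teichmullerInt, sub_self]
  rw [PadicInt.ker_toZMod, PadicInt.maximalIdeal_eq_span_p] at h
  simpa using (PadicInt.norm_le_pow_iff_mem_span_pow _ 1).mpr (by simpa using h)

theorem omega_eq (x : ℤ_[p]) : omega x = toCp p (teichmullerInt p (PadicInt.toZMod x)) := rfl

theorem omega_natCast (a : ℕ) : omega (a : ℤ_[p]) = teichmullerChar p (a : ZMod p) := by
  rw [omega, map_natCast]

theorem norm_omega {x : ℤ_[p]} (hx : IsUnit x) : ‖omega x‖ = 1 := by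
  rw [omega_eq, norm_toCp]
  exact PadicInt.isUnit_iff.mp ((hx.map PadicInt.toZMod).map (teichmullerInt p))

theorem omega_ne_zero {x : ℤ_[p]} (hx : IsUnit x) : omega x ≠ 0 := by
  rw [← norm_ne_zero_iff, norm_omega hx]
  exact one_ne_zero

theorem norm_angle_sub_one_le {x : ℤ_[p]} (hx : IsUnit x) : ‖angle x - 1‖ ≤ (p : ℝ)⁻¹ := by
  rw [angle, div_sub_one (omega_ne_zero hx), norm_div, norm_omega hx, div_one, omega_eq, ← map_sub,
    norm_toCp]
  exact norm_sub_teichmullerInt_le x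

theorem isUnit_natCast {a : ℕ} (ha : ¬ p ∣ a) : IsUnit (a : ℤ_[p]) := by
  rw [PadicInt.isUnit_iff, ← norm_toCp, map_natCast, norm_natCast_eq_one ha]

/-- `ω` depends only on the residue mod `p`, so it cancels in the quotient of the two sides. -/
theorem angle_natCast_add {a : ℕ} (ha : ¬ p ∣ a) {b : ℕ} (hb : p ∣ b) :
    angle ((a + b : ℕ) : ℤ_[p]) =
      angle (a : ℤ_[p]) * (1 + (b : ℂ_[p]) / (a : ℂ_[p])) := by
  have h : ((a + b : ℕ) : ZMod p) = (a : ZMod p) := by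
    rw [Nat.cast_add, (ZMod.natCast_eq_zero_iff b p).mpr hb, add_zero]
  have ha0 : (a : ℂ_[p]) ≠ 0 := by
    rw [← norm_ne_zero_iff, norm_natCast_eq_one ha]
    exact one_ne_zero
  rw [angle, angle, omega_natCast, omega_natCast, h, map_natCast (toCp p), map_natCast (toCp p)]
  push_cast
  field_simp

end Norms

/-! ### Twists -/

section Twist

open DirichletCharacter

theorem natCast_eq_intCast_zmod (a m : ℕ) : (a : ZMod m) = ((a : ℤ) : ZMod m) := by simp

theorem changeLevel_natCast {K : Type*} [CommMonoidWithZero K] {m n : ℕ}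
    (χ : DirichletCharacter K m) (h : m ∣ n) {a : ℕ} (ha : a.Coprime n) :
    changeLevel h χ (a : ZMod n) = χ (a : ZMod m) := by
  rw [natCast_eq_intCast_zmod, natCast_eq_intCast_zmod a m]
  exact changeLevel_eq_cast_of_dvd' χ h (Nat.isCoprime_iff_coprime.mpr ha)

/-- The conductor of one factor divides the least common multiple of the conductor of the product
and the level of the other factor. -/
theorem conductor_dvd_lcm_conductor_mul {K : Type*} [CommMonoidWithZero K] {m n : ℕ} [NeZero m]
    [NeZero n] (χ : DirichletCharacter K m) (ψ : DirichletCharacter K n) :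
    χ.conductor ∣ (χ.mul ψ).conductor.lcm n := by
  have : NeZero (m.lcm n) := ⟨Nat.lcm_ne_zero (NeZero.ne m) (NeZero.ne n)⟩
  -- At the common level, `χ` is the product of `χψ` and `ψ⁻¹`.
  have h := conductor_mul_dvd_lcm_conductor (χ.mul ψ) (changeLevel (Nat.dvd_lcm_right m n) ψ)⁻¹
  rw [mul, mul_inv_cancel_right, conductor_changeLevel, conductor_inv, conductor_changeLevel] at h
  exact h.trans (Nat.lcm_dvd (Nat.dvd_lcm_left _ _) (ψ.conductor_dvd_level.trans (Nat.dvd_lcm_right _ _)))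

variable {p : ℕ} [Fact p.Prime] {d : ℕ}

theorem conductor_twist_dvd_lcm (χ : DirichletCharacter ℂ_[p] d) (n : ℤ) :
    (DirichletCharacter.mul χ (teichmullerChar p ^ (-n))).conductor ∣ d.lcm p :=
  conductor_dvd_level _

/-- The delicate case is `a` not prime to `d`: the primitive twist could be nonzero where the
pointwise product vanishes. Primitivity of `χ` excludes this, since a prime `q ≠ p` dividing `d`
must still divide the conductor of the twist. -/
theorem twist_natCast_mul_omega_zpow [NeZero d] (χ : DirichletCharacter ℂ_[p] d)
    (hχ : χ.IsPrimitive) (n : ℤ) {a : ℕ} (ha : ¬ p ∣ a) :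
    twist χ n (a : ZMod _) * omega (a : ℤ_[p]) ^ n = χ (a : ZMod d) := by
  have hp : p.Prime := Fact.out
  have : NeZero p := ⟨hp.ne_zero⟩
  have hap : a.Coprime p := (hp.coprime_iff_not_dvd.mpr ha).symm
  by_cases had : a.Coprime d
  · have hal : a.Coprime (d.lcm p) :=
      Nat.Coprime.coprime_dvd_right (Nat.lcm_dvd_mul d p) (had.mul_right hap)
    have hu : IsUnit (a : ZMod p) := (ZMod.isUnit_iff_coprime a p).mpr hap
    have h1 : twist χ n (a : ZMod _) =
        DirichletCharacter.mul χ (teichmullerChar p ^ (-n)) (a : ZMod (d.lcm p)) := by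
      rw [natCast_eq_intCast_zmod, natCast_eq_intCast_zmod a (d.lcm p)]
      exact primitiveCharacter_apply_of_isCoprime _ (Nat.isCoprime_iff_coprime.mpr hal)
    have h2 : (teichmullerChar p ^ (-n)) (a : ZMod p) = (omega (a : ℤ_[p]) ^ n)⁻¹ := by
      rw [omega_natCast, ← zpow_neg]
      obtain ⟨u, hu⟩ := hu
      rw [← hu]
      have := congrArg (fun f : (ZMod p)ˣ →* ℂ_[p]ˣ => ((f u : ℂ_[p]ˣ) : ℂ_[p]))
        (map_zpow (MulChar.mulEquivToUnitHom (R := ZMod p) (R' := ℂ_[p])) (teichmullerChar p) (-n))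
      simpa using this
    rw [h1, DirichletCharacter.mul, MulChar.mul_apply, changeLevel_natCast _ _ hal,
      changeLevel_natCast _ _ hal, h2, mul_assoc,
      inv_mul_cancel₀ (zpow_ne_zero _ (omega_ne_zero (isUnit_natCast ha))), mul_one]
  · obtain ⟨q, hq, hqa, hqd⟩ := Nat.Prime.not_coprime_iff_dvd.mp had
    have hqp : ¬ q ∣ p := fun h => ha ((Nat.prime_dvd_prime_iff_eq hq hp).mp h ▸ hqa)
    have hqc : q ∣ (DirichletCharacter.mul χ (teichmullerChar p ^ (-n))).conductor := by
      have h := conductor_dvd_lcm_conductor_mul χ (teichmullerChar p ^ (-n))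
      rw [(isPrimitive_def χ).mp hχ] at h
      exact ((hq.dvd_mul).mp ((hqd.trans h).trans (Nat.lcm_dvd_mul _ _))).resolve_right hqp
    have h0 : twist χ n (a : ZMod _) = 0 := by
      apply MulChar.map_nonunit
      rw [ZMod.isUnit_iff_coprime]
      exact Nat.not_coprime_of_dvd_of_dvd hq.one_lt hqa hqc
    rw [h0, zero_mul, eq_comm]
    apply MulChar.map_nonunit
    rwa [ZMod.isUnit_iff_coprime]

end Twist

end PadicEulerL
namespace PadicEulerL

/-! ### Generating series of Euler numbers -/

section EulerSeries

open PowerSeries Finset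

variable {K : Type*} [Field K] [CharZero K]

theorem expSeries_eq_rescale (a : K) : expSeries a = rescale a (exp K) := by
  ext n
  simp [expSeries, coeff_exp, coeff_rescale, div_eq_mul_inv]

theorem expSeries_zero : expSeries (0 : K) = 1 := by
  ext n
  rcases n with _ | n <;> simp [expSeries, coeff_one]

theorem expSeries_add (a b : K) : expSeries (a + b) = expSeries a * expSeries b := by
  simp only [expSeries_eq_rescale, exp_mul_exp_eq_exp_add]

theorem expSeries_natCast_mul (j : ℕ) (a : K) : expSeries ((j : K) * a) = expSeries a ^ j := by
  induction j with
  | zero => simp [expSeries_zero]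
  | succ j ih => rw [Nat.cast_succ, add_mul, one_mul, expSeries_add, ih, pow_succ]

theorem constantCoeff_expSeries_add_one (a : K) : constantCoeff (expSeries a + 1) = 2 := by
  rw [map_add, map_one, ← coeff_zero_eq_constantCoeff_apply, expSeries, coeff_mk]
  norm_num

theorem expSeries_add_one_ne_zero (a : K) : expSeries a + 1 ≠ 0 := by
  intro h
  have := constantCoeff_expSeries_add_one a
  rw [h, map_zero] at this
  exact two_ne_zero this.symm

/-- The series `2 / (e ^ (c t) + 1)`. -/
noncomputable def eulerSeries (c : K) : PowerSeries K :=
  PowerSeries.mk fun k => (eulerNumber k : K) * c ^ k / (k.factorial : K)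

theorem eulerSeries_mul (c : K) : eulerSeries c * (expSeries c + 1) = C 2 := by
  have h : eulerSeries c = rescale c (map (algebraMap ℚ K) (PowerSeries.C (2 : ℚ) * (exp ℚ + 1)⁻¹)) := by
    ext k
    have hk : (k.factorial : K) ≠ 0 := by exact_mod_cast k.factorial_ne_zero
    rw [coeff_rescale, coeff_map, eulerSeries, coeff_mk, eulerNumber, eq_ratCast (algebraMap ℚ K), Rat.cast_mul,
      Rat.cast_natCast]
    field_simp
  have h2 : expSeries c + 1 = rescale c (map (algebraMap ℚ K) (exp ℚ + 1)) := by
    rw [map_add, map_add, map_one, map_one, map_exp, expSeries_eq_rescale]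
  have h3 : constantCoeff (exp ℚ + 1) ≠ 0 := by
    rw [map_add, constantCoeff_exp, map_one]
    norm_num
  rw [h, h2, ← map_mul, ← map_mul, mul_assoc, PowerSeries.inv_mul_cancel _ h3, mul_one, map_C]
  ext k
  rw [coeff_rescale, coeff_C]
  split_ifs with hk <;> simp [hk, coeff_C]

theorem eulerSeries_eq (c : K) : eulerSeries c = C 2 * (expSeries c + 1)⁻¹ := by
  have h : constantCoeff (expSeries c + 1) ≠ 0 := by
    rw [constantCoeff_expSeries_add_one]
    exact two_ne_zero
  rw [PowerSeries.eq_mul_inv_iff_mul_eq h, eulerSeries_mul]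

/-- The homogenized Euler polynomial `∑ binom(n, k) x ^ (n - k) c ^ k E_k`. -/
noncomputable def eulerSum (n : ℕ) (x c : K) : K :=
  ∑ k ∈ range (n + 1), (n.choose k : K) * x ^ (n - k) * c ^ k * (eulerNumber k : K)

theorem factorial_mul_coeff_expSeries_mul_eulerSeries (n : ℕ) (x c : K) :
    (n.factorial : K) * coeff n (expSeries x * eulerSeries c) = eulerSum n x c := by
  rw [mul_comm (expSeries x), coeff_mul, Nat.sum_antidiagonal_eq_sum_range_succ_mk, mul_sum,
    eulerSum]
  refine sum_congr rfl fun k hk => ?_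
  have hkn : k ≤ n := Nat.lt_succ_iff.mp (mem_range.mp hk)
  have h1 : (k.factorial : K) ≠ 0 := by exact_mod_cast k.factorial_ne_zero
  have h2 : ((n - k).factorial : K) ≠ 0 := by exact_mod_cast (n - k).factorial_ne_zero
  rw [eulerSeries, expSeries, coeff_mk, coeff_mk, Nat.cast_choose K hkn]
  field_simp

theorem eulerSum_zero_left (n : ℕ) : eulerSum n (0 : K) 1 = eulerNumber n := by
  rw [← factorial_mul_coeff_expSeries_mul_eulerSeries, expSeries_zero, one_mul, eulerSeries,
    coeff_mk, one_pow, mul_one]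
  have h1 : (n.factorial : K) ≠ 0 := by exact_mod_cast n.factorial_ne_zero
  field_simp

omit [CharZero K] in
theorem eulerSum_mul (n : ℕ) (b x c : K) : eulerSum n (b * x) (b * c) = b ^ n * eulerSum n x c := by
  rw [eulerSum, eulerSum, mul_sum]
  refine sum_congr rfl fun k hk => ?_
  have hkn : k ≤ n := Nat.lt_succ_iff.mp (mem_range.mp hk)
  rw [mul_pow, mul_pow, ← Nat.sub_add_cancel hkn, pow_add b (n - k) k]
  simp only [Nat.sub_add_cancel hkn]
  ring

/-- Coefficients of `(2 / (e ^ t + 1)) (e ^ t + 1) = 2`; this is the recurrence behind the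
integrality of `E_n`. -/
theorem eulerSum_one_add (n : ℕ) :
    eulerSum n (1 : K) 1 + eulerNumber n = if n = 0 then 2 else 0 := by
  have h := congrArg (fun f => (n.factorial : K) * coeff n f) (eulerSeries_mul (1 : K))
  have h0 := factorial_mul_coeff_expSeries_mul_eulerSeries (K := K) n 0 1
  simp only [mul_add, mul_one, map_add] at h
  rw [expSeries_zero, one_mul, eulerSum_zero_left] at h0
  rw [mul_comm (eulerSeries 1), factorial_mul_coeff_expSeries_mul_eulerSeries, h0] at h
  rw [h, coeff_C]
  split_ifs with hn <;> simp [hn]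

theorem sum_neg_one_pow_mul_pow_mul_add_one {R : Type*} [CommRing R] (x : R) {M : ℕ} (hM : Odd M) :
    (∑ j ∈ range M, (-1) ^ j * x ^ j) * (x + 1) = x ^ M + 1 := by
  have h := geom_sum_mul (-x) M
  rw [hM.neg_pow] at h
  simp_rw [← mul_pow, neg_one_mul]
  linear_combination -h

/-- Coefficients of `2 ∑ (-1) ^ j e ^ (j t) = (e ^ (M t) + 1) · 2 / (e ^ t + 1)`, a geometric sum
with `M` odd. -/
theorem two_mul_alternating_sum_pow {M : ℕ} (hM : Odd M) (n : ℕ) :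
    2 * ∑ j ∈ range M, (-1) ^ j * (j : K) ^ n = eulerSum n (M : K) 1 + eulerNumber n := by
  have h := sum_neg_one_pow_mul_pow_mul_add_one (expSeries (1 : K)) hM
  simp only [← expSeries_natCast_mul, mul_one] at h
  have h2 : C (2 : K) * ∑ j ∈ range M, (-1) ^ j * expSeries (j : K) =
      expSeries (M : K) * eulerSeries 1 + expSeries 0 * eulerSeries 1 := by
    rw [← eulerSeries_mul (1 : K), expSeries_zero, ← add_mul, ← h]
    ring
  have h3 := congrArg (fun f => (n.factorial : K) * coeff n f) h2
  simp only [map_add, mul_add, factorial_mul_coeff_expSeries_mul_eulerSeries,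
    eulerSum_zero_left] at h3
  rw [← h3, coeff_C_mul, map_sum, mul_left_comm, mul_sum (a := (n.factorial : K))]
  congr 1
  refine sum_congr rfl fun j _ => ?_
  have h1 : (n.factorial : K) ≠ 0 := by exact_mod_cast n.factorial_ne_zero
  have h4 : ((-1) ^ j : PowerSeries K) = C ((-1) ^ j) := by simp
  rw [h4, coeff_C_mul, expSeries, coeff_mk]
  field_simp

/-! ### Generalized Euler numbers -/

theorem sum_Icc_one_mul {M : Type*} [AddCommMonoid M] (m c : ℕ) (f : ℕ → M) :
    ∑ a ∈ Icc 1 (m * c), f a = ∑ j ∈ range c, ∑ a ∈ Icc 1 m, f (a + m * j) := by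
  induction c with
  | zero => simp
  | succ c ih =>
    rw [sum_range_succ, ← ih, mul_add, mul_one]
    have h : Icc 1 (m * c + m) = Icc 1 (m * c) ∪ (Icc 1 m).map (addRightEmbedding (m * c)) := by
      ext x
      simp only [map_add_right_Icc, mem_union, mem_Icc]
      omega
    rw [h, sum_union, sum_map]
    · simp
    · rw [map_add_right_Icc, disjoint_left]
      intro x hx hx2
      rw [mem_Icc] at hx hx2
      omega

/-- Passing from `m` to an odd multiple `m c` multiplies numerator and denominator of the generating
function by the same alternating geometric sum in `e ^ (m t)`; signs split because `m` is odd. -/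
theorem genEulerNumber_eq_sum {m M : ℕ} (ψ : DirichletCharacter K m) (hmM : m ∣ M) (hM : Odd M)
    (n : ℕ) :
    genEulerNumber ψ n =
      ∑ a ∈ Icc 1 M, (-1) ^ a * ψ (a : ZMod m) * eulerSum n (a : K) (M : K) := by
  obtain ⟨c, rfl⟩ := hmM
  have hm : Odd m := (Nat.odd_mul.mp hM).1
  have hc : Odd c := (Nat.odd_mul.mp hM).2
  have hT : (∑ a ∈ Icc 1 (m * c), C ((-1) ^ a * ψ (a : ZMod m)) * expSeries (a : K)) =
      (∑ a ∈ Icc 1 m, C ((-1) ^ a * ψ (a : ZMod m)) * expSeries (a : K)) *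
        ∑ j ∈ range c, (-1) ^ j * expSeries (m : K) ^ j := by
    rw [sum_Icc_one_mul, mul_sum]
    refine sum_congr rfl fun j _ => ?_
    rw [sum_mul]
    refine sum_congr rfl fun a _ => ?_
    have h1 : ((a + m * j : ℕ) : ZMod m) = a := by simp
    have h2 : ((a + m * j : ℕ) : K) = a + j * m := by push_cast; ring
    have h3 : ((-1) ^ (a + m * j) : K) = (-1) ^ a * (-1) ^ j := by
      rw [pow_add, pow_mul, hm.neg_one_pow]
    rw [h1, h2, h3, expSeries_add, expSeries_natCast_mul]
    simp only [map_mul, map_pow, map_neg, map_one]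
    ring
  have hS : C (2 : K) * (∑ a ∈ Icc 1 m, C ((-1) ^ a * ψ (a : ZMod m)) * expSeries (a : K)) *
      (expSeries (m : K) + 1)⁻¹ =
      (∑ a ∈ Icc 1 (m * c), C ((-1) ^ a * ψ (a : ZMod m)) * expSeries (a : K)) *
        eulerSeries ((m * c : ℕ) : K) := by
    have hg := sum_neg_one_pow_mul_pow_mul_add_one (expSeries (m : K)) hc
    rw [← expSeries_natCast_mul] at hg
    have e1 := eulerSeries_mul (m : K)
    have e2 := eulerSeries_mul ((m * c : ℕ) : K)
    rw [show ((m * c : ℕ) : K) = c * m by push_cast; ring] at e2 ⊢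
    apply mul_right_cancel₀ (mul_ne_zero (expSeries_add_one_ne_zero (m : K))
      (expSeries_add_one_ne_zero ((c : K) * m)))
    rw [mul_right_comm (C (2 : K)) _ (expSeries (m : K) + 1)⁻¹, ← eulerSeries_eq, hT]
    generalize (∑ a ∈ Icc 1 m, C ((-1) ^ a * ψ (a : ZMod m)) * expSeries (a : K)) = T at *
    generalize (∑ j ∈ range c, (-1) ^ j * expSeries (m : K) ^ j) = S at *
    linear_combination (T * (expSeries ((c : K) * m) + 1)) * e1 -
      T * S * (expSeries (m : K) + 1) * e2 - C 2 * T * hg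
  rw [genEulerNumber, hS, sum_mul, map_sum, mul_sum]
  refine sum_congr rfl fun a _ => ?_
  rw [mul_assoc (C _), coeff_C_mul, mul_left_comm, factorial_mul_coeff_expSeries_mul_eulerSeries]

/-- Removing the Euler factor at `p`. -/
theorem sum_filter_not_dvd_eulerSum {p m F : ℕ} (hp : p.Prime) (ψ : DirichletCharacter K m)
    (hmF : m ∣ F) (hpF : p ∣ F) (hF : Odd F) (n : ℕ) :
    ∑ a ∈ (Icc 1 F).filter (fun a => ¬ p ∣ a),
        (-1) ^ a * ψ (a : ZMod m) * eulerSum n (a : K) (F : K) =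
      genEulerNumber ψ n - (p : K) ^ n * ψ (p : ZMod m) * genEulerNumber ψ n := by
  have hsplit := sum_filter_add_sum_filter_not (Icc 1 F) (fun a => p ∣ a)
    (fun a => (-1) ^ a * ψ (a : ZMod m) * eulerSum n (a : K) (F : K))
  rw [← genEulerNumber_eq_sum ψ hmF hF] at hsplit
  suffices h : ∑ a ∈ (Icc 1 F).filter (fun a => p ∣ a),
      (-1) ^ a * ψ (a : ZMod m) * eulerSum n (a : K) (F : K) =
      (p : K) ^ n * ψ (p : ZMod m) * genEulerNumber ψ n by
    linear_combination hsplit - h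
  obtain ⟨F', rfl⟩ := hpF
  have hp2 : Odd p := (Nat.odd_mul.mp hF).1
  have hset : (Icc 1 (p * F')).filter (fun a => p ∣ a) = (Icc 1 F').image (fun b => p * b) := by
    ext x
    simp only [mem_filter, mem_image, mem_Icc]
    constructor
    · rintro ⟨⟨h1, h2⟩, b, rfl⟩
      exact ⟨b, ⟨Nat.pos_of_ne_zero (by rintro rfl; simp at h1), Nat.le_of_mul_le_mul_left h2 hp.pos⟩, rfl⟩
    · rintro ⟨b, ⟨h1, h2⟩, rfl⟩
      exact ⟨⟨Nat.mul_pos hp.pos h1, Nat.mul_le_mul_left p h2⟩, dvd_mul_right p b⟩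
  rw [hset, sum_image (fun a _ b _ h => Nat.eq_of_mul_eq_mul_left hp.pos h)]
  have hterm : ∀ b : ℕ, (-1 : K) ^ (p * b) * ψ ((p * b : ℕ) : ZMod m) *
      eulerSum n ((p * b : ℕ) : K) ((p * F' : ℕ) : K) =
      (p : K) ^ n * ψ (p : ZMod m) *
        ((-1) ^ b * ψ (b : ZMod m) * eulerSum n (b : K) (F' : K)) := by
    intro b
    rw [pow_mul, hp2.neg_one_pow, Nat.cast_mul, Nat.cast_mul, Nat.cast_mul, map_mul, eulerSum_mul]
    ring
  rw [sum_congr rfl fun b _ => hterm b, ← mul_sum]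
  -- If `p ∣ m` then `ψ(p) = 0`. Otherwise `m` divides `F' = F / p`, so `F'` is itself an admissible
  -- modulus.
  by_cases hpm : p ∣ m
  · have h0 : ψ (p : ZMod m) = 0 := by
      apply MulChar.map_nonunit
      rw [ZMod.isUnit_iff_coprime]
      exact Nat.not_coprime_of_dvd_of_dvd hp.one_lt dvd_rfl hpm
    simp [h0]
  · rw [← genEulerNumber_eq_sum ψ _ (Nat.odd_mul.mp hF).2]
    exact ((hp.coprime_iff_not_dvd.mpr hpm).symm).dvd_of_dvd_mul_left hmF

end EulerSeries

/-! ### Bounds for Euler numbers -/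

section EulerBounds

open Finset

variable {p : ℕ} [Fact p.Prime]

theorem norm_sum_le_of_forall_le {ι : Type*} {s : Finset ι} {f : ι → ℂ_[p]} {r : ℝ} (hr : 0 ≤ r)
    (h : ∀ i ∈ s, ‖f i‖ ≤ r) : ‖∑ i ∈ s, f i‖ ≤ r :=
  IsUltrametricDist.norm_sum_le_of_forall_le_of_nonneg hr h

theorem norm_two (hp : p ≠ 2) : ‖(2 : ℂ_[p])‖ = 1 := by
  have := norm_natCast_eq_one (p := p) (n := 2) fun h =>
    hp ((Nat.prime_dvd_prime_iff_eq Fact.out Nat.prime_two).mp h)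
  simpa using this

theorem norm_eulerNumber_le_one (hp : p ≠ 2) (n : ℕ) : ‖(eulerNumber n : ℂ_[p])‖ ≤ 1 := by
  induction n using Nat.strong_induction_on with
  | _ n ih =>
    have h := eulerSum_one_add (K := ℂ_[p]) n
    rw [eulerSum, sum_range_succ, Nat.choose_self, Nat.sub_self] at h
    have h2 : 2 * (eulerNumber n : ℂ_[p]) = (if n = 0 then 2 else 0) -
        ∑ k ∈ range n, (n.choose k : ℂ_[p]) * 1 ^ (n - k) * 1 ^ k * (eulerNumber k : ℂ_[p]) := by
      rw [← h]
      push_cast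
      ring
    rw [← one_mul ‖_‖, ← norm_two hp, ← norm_mul, h2, norm_two hp, sub_eq_add_neg]
    refine (IsUltrametricDist.norm_add_le_max _ _).trans (max_le ?_ ?_)
    · split_ifs
      · exact (norm_two hp).le
      · simp
    · rw [norm_neg]
      refine norm_sum_le_of_forall_le zero_le_one fun k hk => ?_
      rw [one_pow, one_pow, mul_one, mul_one, norm_mul]
      exact mul_le_one₀ (norm_natCast_le_one _) (norm_nonneg _) (ih k (mem_range.mp hk))

/-- In `eulerSum n M 1` every term except `k = n` carries a factor `M`, and that last term joins the
other `E_n` to give `2 E_n`. The bound is uniform in `n`. -/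
theorem norm_alternating_sum_pow_sub_le (hp : p ≠ 2) {M : ℕ} (hM : Odd M) (n : ℕ) :
    ‖(∑ j ∈ range M, (-1) ^ j * (j : ℂ_[p]) ^ n) - eulerNumber n‖ ≤ ‖(M : ℂ_[p])‖ := by
  have h := two_mul_alternating_sum_pow (K := ℂ_[p]) hM n
  rw [eulerSum, sum_range_succ, Nat.choose_self, Nat.sub_self] at h
  have h2 : 2 * ((∑ j ∈ range M, (-1) ^ j * (j : ℂ_[p]) ^ n) - eulerNumber n) =
      ∑ k ∈ range n, (n.choose k : ℂ_[p]) * M ^ (n - k) * 1 ^ k * (eulerNumber k : ℂ_[p]) := by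
    rw [mul_sub, h]
    push_cast
    ring
  rw [← one_mul ‖_ - _‖, ← norm_two hp, ← norm_mul, h2]
  refine norm_sum_le_of_forall_le (norm_nonneg _) fun k hk => ?_
  have hk' : n - k ≠ 0 := (Nat.sub_pos_of_lt (mem_range.mp hk)).ne'
  rw [one_pow, mul_one, norm_mul, norm_mul, norm_pow]
  refine mul_le_of_le_one_right (by positivity) (norm_eulerNumber_le_one hp k) |>.trans ?_
  refine mul_le_of_le_one_left (by positivity) (norm_natCast_le_one _) |>.trans ?_
  exact pow_le_of_le_one (norm_nonneg _) (norm_natCast_le_one _) hk'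

end EulerBounds

end PadicEulerL
namespace PadicEulerL

/-! ### Functions given by a power series on a disc -/

section PowerSeriesOn

variable {p : ℕ} [Fact p.Prime]

/-- `f` is given on the open disc of radius `R` around `0` by a single power series that converges
absolutely there. -/
def IsPowerSeriesOn (R : ℝ) (f : ℂ_[p] → ℂ_[p]) : Prop :=
  ∃ a : ℕ → ℂ_[p], (∀ r : ℝ, 0 ≤ r → r < R → Summable fun j => ‖a j‖ * r ^ j) ∧
    ∀ s : ℂ_[p], ‖s‖ < R → HasSum (fun j => a j * s ^ j) (f s)

namespace IsPowerSeriesOn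

variable {R : ℝ} {f g : ℂ_[p] → ℂ_[p]}

theorem const (c : ℂ_[p]) : IsPowerSeriesOn R fun _ => c := by
  refine ⟨fun j => if j = 0 then c else 0, fun r _ _ => ?_, fun s _ => ?_⟩
  · exact summable_of_ne_finset_zero (s := {0}) fun j hj => by
      simp [Finset.mem_singleton.not.mp hj]
  · convert hasSum_single (f := fun j => (if j = 0 then c else 0) * s ^ j) 0 ?_ using 1
    · simp
    · intro j hj
      simp [hj]

theorem add (hf : IsPowerSeriesOn R f) (hg : IsPowerSeriesOn R g) :
    IsPowerSeriesOn R fun s => f s + g s := by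
  obtain ⟨a, ha, ha'⟩ := hf
  obtain ⟨b, hb, hb'⟩ := hg
  refine ⟨fun j => a j + b j, fun r h0 hr => ?_, fun s hs => ?_⟩
  · refine Summable.of_nonneg_of_le (fun j => by positivity) (fun j => ?_)
      ((ha r h0 hr).add (hb r h0 hr))
    rw [← add_mul]
    gcongr
    exact norm_add_le _ _
  · simpa only [add_mul] using (ha' s hs).add (hb' s hs)

theorem sum {ι : Type*} (t : Finset ι) {f : ι → ℂ_[p] → ℂ_[p]}
    (hf : ∀ i ∈ t, IsPowerSeriesOn R (f i)) : IsPowerSeriesOn R fun s => ∑ i ∈ t, f i s := by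
  classical
  induction t using Finset.induction_on with
  | empty => simpa using const 0
  | insert i t hi ih =>
    simp only [Finset.sum_insert hi]
    exact (hf i (Finset.mem_insert_self i t)).add
      (ih fun j hj => hf j (Finset.mem_insert_of_mem hj))

theorem mul (hf : IsPowerSeriesOn R f) (hg : IsPowerSeriesOn R g) :
    IsPowerSeriesOn R fun s => f s * g s := by
  obtain ⟨a, ha, ha'⟩ := hf
  obtain ⟨b, hb, hb'⟩ := hg
  have key : ∀ (s : ℂ_[p]) (n : ℕ), ∑ kl ∈ Finset.HasAntidiagonal.antidiagonal n, a kl.1 * s ^ kl.1 *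
      (b kl.2 * s ^ kl.2) = (∑ kl ∈ Finset.HasAntidiagonal.antidiagonal n, a kl.1 * b kl.2) * s ^ n := by
    intro s n
    rw [Finset.sum_mul]
    refine Finset.sum_congr rfl fun kl hkl => ?_
    rw [← Finset.HasAntidiagonal.mem_antidiagonal.mp hkl, pow_add]
    ring
  refine ⟨fun n => ∑ kl ∈ Finset.HasAntidiagonal.antidiagonal n, a kl.1 * b kl.2, fun r h0 hr => ?_,
    fun s hs => ?_⟩
  · have h := summable_norm_sum_mul_antidiagonal_of_summable_norm (ha r h0 hr).norm
      (hb r h0 hr).norm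
    refine Summable.of_nonneg_of_le (fun j => by positivity) (fun n => ?_) h
    refine le_trans ?_ (le_abs_self _)
    refine (mul_le_mul_of_nonneg_right (norm_sum_le _ _) (pow_nonneg h0 n)).trans_eq ?_
    rw [Finset.sum_mul]
    refine Finset.sum_congr rfl fun kl hkl => ?_
    rw [← Finset.HasAntidiagonal.mem_antidiagonal.mp hkl, pow_add, norm_mul]
    ring
  · have h1 : Summable fun j => ‖a j * s ^ j‖ := by
      simpa only [norm_mul, norm_pow] using ha ‖s‖ (norm_nonneg s) hs
    have h2 : Summable fun j => ‖b j * s ^ j‖ := by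
      simpa only [norm_mul, norm_pow] using hb ‖s‖ (norm_nonneg s) hs
    have h := (summable_norm_sum_mul_antidiagonal_of_summable_norm h1 h2).of_norm.hasSum
    rw [← tsum_mul_tsum_eq_tsum_sum_antidiagonal_of_summable_norm h1 h2, (ha' s hs).tsum_eq,
      (hb' s hs).tsum_eq] at h
    simpa only [key] using h

theorem comp_neg (hf : IsPowerSeriesOn R f) : IsPowerSeriesOn R fun s => f (-s) := by
  obtain ⟨a, ha, ha'⟩ := hf
  refine ⟨fun j => a j * (-1) ^ j, fun r h0 hr => ?_, fun s hs => ?_⟩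
  · simpa using ha r h0 hr
  · have h := ha' (-s) (by rwa [norm_neg])
    convert h using 2 with j
    rw [neg_pow s, mul_assoc]

theorem hasFPowerSeriesOnBall (hR : 0 < R) {a : ℕ → ℂ_[p]}
    (ha : ∀ r : ℝ, 0 ≤ r → r < R → Summable fun j => ‖a j‖ * r ^ j)
    (ha' : ∀ s : ℂ_[p], ‖s‖ < R → HasSum (fun j => a j * s ^ j) (f s)) :
    HasFPowerSeriesOnBall f (FormalMultilinearSeries.ofScalars ℂ_[p] a) 0 (ENNReal.ofReal R) where
  r_le := by
    refine ENNReal.le_of_forall_nnreal_lt fun r hr => ?_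
    refine FormalMultilinearSeries.le_radius_of_summable _ ?_
    simp only [FormalMultilinearSeries.ofScalars_norm]
    exact ha r r.2 ((ENNReal.lt_ofReal_iff_toReal_lt ENNReal.coe_ne_top).mp hr)
  r_pos := ENNReal.ofReal_pos.mpr hR
  hasSum := by
    intro y hy
    rw [Metric.eball_ofReal, mem_ball_zero_iff] at hy
    simpa only [FormalMultilinearSeries.ofScalars_apply_eq, smul_eq_mul, zero_add] using ha' y hy

theorem tendsto_prime_pow : Tendsto (fun N : ℕ => ((p ^ N : ℕ) : ℂ_[p])) atTop (𝓝[≠] 0) := by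
  have hp : p.Prime := Fact.out
  rw [tendsto_nhdsWithin_iff]
  constructor
  · push_cast
    refine tendsto_pow_atTop_nhds_zero_of_norm_lt_one ?_
    rw [norm_natCast_prime]
    exact inv_lt_one_of_one_lt₀ (by exact_mod_cast hp.one_lt)
  · exact Eventually.of_forall fun N => by
      have := hp.ne_zero
      simp [this]

/-- Two functions given by power series on a disc agree there when they agree at the positive
integers, since these accumulate at `0`. -/
theorem eq_of_eq_natCast (hR : 0 < R) (hf : IsPowerSeriesOn R f) (hg : IsPowerSeriesOn R g)
    (h : ∀ n : ℕ, 0 < n → f n = g n) {s : ℂ_[p]} (hs : ‖s‖ < R) : f s = g s := by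
  obtain ⟨a, ha, ha'⟩ := hf
  obtain ⟨b, hb, hb'⟩ := hg
  have hF := hasFPowerSeriesOnBall hR ha ha'
  have hG := hasFPowerSeriesOnBall hR hb hb'
  have hfreq : ∃ᶠ z in 𝓝[≠] (0 : ℂ_[p]), f z = g z :=
    tendsto_prime_pow.frequently (Frequently.of_forall fun N =>
      h _ (pow_pos (Fact.out : p.Prime).pos N))
  have hev := (hF.analyticAt.frequently_eq_iff_eventually_eq hG.analyticAt).mp hfreq
  -- Coefficients are compared at `0` and then used on the whole disc, so no connectedness is
  -- involved.
  have heq := hF.hasFPowerSeriesAt.eq_formalMultilinearSeries_of_eventually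
    hG.hasFPowerSeriesAt hev
  rw [(FormalMultilinearSeries.ofScalars_series_injective ℂ_[p] ℂ_[p]) heq] at ha'
  exact (ha' s hs).unique (hb' s hs)

end IsPowerSeriesOn

end PowerSeriesOn

/-! ### Binomial series -/

section Binomial

variable {p : ℕ} [Fact p.Prime]

theorem one_lt_discRadius (hp : p ≠ 2) : 1 < discRadius p := by
  have h2 : 2 < p := lt_of_le_of_ne (Fact.out : p.Prime).two_le hp.symm
  have h3 : (3 : ℝ) ≤ p := by exact_mod_cast h2
  apply Real.one_lt_rpow (by linarith)
  rw [sub_pos, div_lt_one (by linarith)]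
  linarith

/-- Legendre: `(p - 1) v_p(k!) = k - s_p(k) ≤ k`, with `s_p` the digit sum in base `p`. -/
theorem inv_norm_factorial_le (k : ℕ) :
    ‖(k.factorial : ℂ_[p])‖⁻¹ ≤ ((p : ℝ) ^ (1 / ((p : ℝ) - 1))) ^ k := by
  have hp : p.Prime := Fact.out
  have hp1 : (1 : ℝ) < p := by exact_mod_cast hp.one_lt
  have hv := sub_one_mul_padicValNat_factorial (p := p) k
  have hv' : ((p : ℝ) - 1) * padicValNat p k.factorial ≤ k := by
    rw [← Nat.cast_pred hp.pos]
    exact_mod_cast hv.trans_le (Nat.sub_le _ _)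
  have hk : ((k.factorial : ℕ) : ℚ_[p]) ≠ 0 := by exact_mod_cast k.factorial_ne_zero
  rw [norm_natCast_eq, Padic.norm_eq_zpow_neg_valuation hk, Padic.valuation_natCast, zpow_neg,
    inv_inv, zpow_natCast, ← Real.rpow_natCast, ← Real.rpow_natCast, ← Real.rpow_mul (by linarith)]
  apply Real.rpow_le_rpow_of_exponent_le hp1.le
  rw [one_div, inv_mul_eq_div, le_div_iff₀ (by linarith)]
  linarith

/-- The coefficients of `binom s k` as a polynomial in `s`. -/
noncomputable def binomCoeff (p : ℕ) [Fact p.Prime] (k j : ℕ) : ℂ_[p] :=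
  ((descPochhammer ℤ k).coeff j : ℂ_[p]) / (k.factorial : ℂ_[p])

theorem binom_eq_descPochhammer {K : Type*} [Field K] (s : K) (k : ℕ) :
    binom s k = (descPochhammer K k).eval s / (k.factorial : K) := by
  rw [binom, descPochhammer_eval_eq_prod_range]

theorem binom_natCast {K : Type*} [Field K] [CharZero K] (m k : ℕ) :
    binom (m : K) k = (m.choose k : K) := by
  rw [binom_eq_descPochhammer, Nat.cast_choose_eq_descPochhammer_div]

theorem binomCoeff_eq_zero {k j : ℕ} (h : k < j) : binomCoeff p k j = 0 := by
  rw [binomCoeff, Polynomial.coeff_eq_zero_of_natDegree_lt, Int.cast_zero, zero_div]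
  rwa [descPochhammer_natDegree]

theorem binom_eq_sum (s : ℂ_[p]) (k : ℕ) :
    binom s k = ∑ j ∈ Finset.range (k + 1), binomCoeff p k j * s ^ j := by
  rw [binom_eq_descPochhammer, ← descPochhammer_map (Int.castRingHom ℂ_[p]),
    Polynomial.eval_eq_sum_range' (n := k + 1)]
  · rw [Finset.sum_div]
    refine Finset.sum_congr rfl fun j _ => ?_
    rw [Polynomial.coeff_map, binomCoeff, eq_intCast, div_mul_eq_mul_div]
  · rw [descPochhammer_map, descPochhammer_natDegree]
    exact Nat.lt_succ_self k

theorem norm_intCast_le_one (z : ℤ) : ‖(z : ℂ_[p])‖ ≤ 1 := by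
  obtain ⟨n, rfl | rfl⟩ := z.eq_nat_or_neg
  · simpa using norm_natCast_le_one n
  · simpa using norm_natCast_le_one n

/-- Only the `k!` in the denominator costs anything, and `p ^ (k / (p - 1)) · p ^ (-k)` is the
`-k`-th power of the radius. -/
theorem norm_binomCoeff_mul_le {c : ℕ → ℂ_[p]} (hc : ∀ k, ‖c k‖ ≤ ((p : ℝ)⁻¹) ^ k) (k j : ℕ) :
    ‖binomCoeff p k j * c k‖ ≤ ((discRadius p)⁻¹) ^ k := by
  have hp0 : (0 : ℝ) < p := by exact_mod_cast (Fact.out : p.Prime).pos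
  have hR : (discRadius p)⁻¹ = (p : ℝ) ^ (1 / ((p : ℝ) - 1)) * (p : ℝ)⁻¹ := by
    rw [discRadius, Real.rpow_sub hp0, Real.rpow_one, inv_div, div_eq_mul_inv]
  rw [norm_mul, binomCoeff, norm_div, div_eq_mul_inv, hR, mul_pow]
  refine mul_le_mul ?_ (hc k) (norm_nonneg _) (by positivity)
  exact (mul_le_of_le_one_left (by positivity) (norm_intCast_le_one _)).trans
    (inv_norm_factorial_le k)

theorem summable_norm_binomCoeff_mul (hp : p ≠ 2) {c : ℕ → ℂ_[p]}
    (hc : ∀ k, ‖c k‖ ≤ ((p : ℝ)⁻¹) ^ k) {r : ℝ} (h0 : 0 ≤ r) (hr : r < discRadius p) :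
    Summable fun x : ℕ × ℕ => ‖binomCoeff p x.1 x.2 * c x.1‖ * r ^ x.2 := by
  have hR := one_lt_discRadius hp
  have hR0 : 0 < discRadius p := by linarith
  -- The maximum with `1` allows `r ^ j` to be replaced by a `k`-th power for all `j ≤ k`, so row
  -- `k` sums to at most `(k + 1) q ^ k`.
  set q : ℝ := max r 1 * (discRadius p)⁻¹ with hq
  have hq0 : 0 ≤ q := by positivity
  have hq1 : q < 1 := by
    rw [hq, ← div_eq_mul_inv, div_lt_one hR0]
    exact max_lt hr hR
  have hzero : ∀ k j : ℕ, j ∉ Finset.range (k + 1) → ‖binomCoeff p k j * c k‖ * r ^ j = 0 := by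
    intro k j hj
    rw [binomCoeff_eq_zero (by simpa using hj)]
    simp
  rw [summable_prod_of_nonneg fun x => by positivity]
  refine ⟨fun k => summable_of_ne_finset_zero (hzero k), ?_⟩
  have hmaj : Summable fun k : ℕ => (k : ℝ) ^ 1 * q ^ k + q ^ k :=
    (summable_pow_mul_geometric_of_norm_lt_one 1 (by rwa [Real.norm_of_nonneg hq0])).add
      (summable_geometric_of_lt_one hq0 hq1)
  refine Summable.of_nonneg_of_le (fun k => tsum_nonneg fun j => by positivity) (fun k => ?_) hmaj
  rw [tsum_eq_sum (hzero k)]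
  calc ∑ j ∈ Finset.range (k + 1), ‖binomCoeff p k j * c k‖ * r ^ j
      ≤ ∑ j ∈ Finset.range (k + 1), q ^ k := by
        refine Finset.sum_le_sum fun j hj => ?_
        rw [hq, mul_pow, mul_comm]
        refine mul_le_mul ?_ (norm_binomCoeff_mul_le hc k j) (norm_nonneg _) (by positivity)
        calc r ^ j ≤ max r 1 ^ j := pow_le_pow_left₀ h0 (le_max_left _ _) j
          _ ≤ max r 1 ^ k := pow_le_pow_right₀ (le_max_right _ _)
            (Nat.lt_succ_iff.mp (Finset.mem_range.mp hj))
    _ = (k : ℝ) ^ 1 * q ^ k + q ^ k := by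
        rw [Finset.sum_const, Finset.card_range, nsmul_eq_mul]
        push_cast
        ring

theorem hasSum_binomCoeff_mul (c : ℕ → ℂ_[p]) (s : ℂ_[p]) (k : ℕ) :
    HasSum (fun j => binomCoeff p k j * c k * s ^ j) (binom s k * c k) := by
  rw [binom_eq_sum, Finset.sum_mul, Finset.sum_congr rfl fun j _ => mul_right_comm _ _ _]
  refine hasSum_sum_of_ne_finset_zero fun j hj => ?_
  rw [binomCoeff_eq_zero (by simpa using hj)]
  simp

theorem summable_binom_mul (hp : p ≠ 2) {c : ℕ → ℂ_[p]} (hc : ∀ k, ‖c k‖ ≤ ((p : ℝ)⁻¹) ^ k)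
    {s : ℂ_[p]} (hs : ‖s‖ < discRadius p) : Summable fun k => binom s k * c k := by
  have h := summable_norm_binomCoeff_mul hp hc (norm_nonneg s) hs
  have h' : Summable fun x : ℕ × ℕ => binomCoeff p x.1 x.2 * c x.1 * s ^ x.2 :=
    Summable.of_norm (by simpa only [norm_mul, norm_pow] using h)
  exact h'.prod.congr fun k => (hasSum_binomCoeff_mul c s k).tsum_eq

/-- A binomial series `∑ binom(s, k) c_k` with `|c_k| ≤ p ^ (-k)` is a power series in `s` on the
disc of radius `p ^ (1 - 1 / (p - 1))`. -/
theorem isPowerSeriesOn_tsum_binom_mul (hp : p ≠ 2) {c : ℕ → ℂ_[p]}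
    (hc : ∀ k, ‖c k‖ ≤ ((p : ℝ)⁻¹) ^ k) :
    IsPowerSeriesOn (discRadius p) fun s => ∑' k, binom s k * c k := by
  refine ⟨fun j => ∑' k, binomCoeff p k j * c k, fun r h0 hr => ?_, fun s hs => ?_⟩
  · have hR := one_lt_discRadius hp
    have h1 : ∀ j, Summable fun k => ‖binomCoeff p k j * c k‖ := fun j => by
      refine Summable.of_nonneg_of_le (fun k => norm_nonneg _)
        (fun k => norm_binomCoeff_mul_le hc k j) ?_
      exact summable_geometric_of_lt_one (by positivity) (inv_lt_one_of_one_lt₀ hR)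
    refine Summable.of_nonneg_of_le (fun j => by positivity) (fun j => ?_)
      (summable_norm_binomCoeff_mul hp hc h0 hr).prod_symm.prod
    simp only [Prod.fst_swap, Prod.snd_swap]
    rw [tsum_mul_right (f := fun k => ‖binomCoeff p k j * c k‖)]
    gcongr
    exact norm_tsum_le_tsum_norm (h1 j)
  · have h : Summable fun x : ℕ × ℕ => binomCoeff p x.1 x.2 * c x.1 * s ^ x.2 :=
      Summable.of_norm (by
        simpa only [norm_mul, norm_pow] using
          summable_norm_binomCoeff_mul hp hc (norm_nonneg s) hs)
    have h2 := h.prod_symm.prod.hasSum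
    have h3 : ∑' (j : ℕ) (k : ℕ), binomCoeff p k j * c k * s ^ j = ∑' k, binom s k * c k := by
      rw [Summable.tsum_comm (f := fun k j => binomCoeff p k j * c k * s ^ j) h]
      exact tsum_congr fun k => (hasSum_binomCoeff_mul c s k).tsum_eq
    simp only [Prod.fst_swap, Prod.snd_swap] at h2
    rw [h3] at h2
    simpa only [tsum_mul_right] using h2

theorem tsum_binom_natCast_mul {K : Type*} [Field K] [CharZero K] [TopologicalSpace K] (m : ℕ)
    (c : ℕ → K) :
    ∑' k, binom (m : K) k * c k = ∑ k ∈ Finset.range (m + 1), (m.choose k : K) * c k := by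
  rw [tsum_eq_sum (s := Finset.range (m + 1))]
  · exact Finset.sum_congr rfl fun k _ => by rw [binom_natCast]
  · intro k hk
    rw [binom_natCast, Nat.choose_eq_zero_of_lt (by simpa using hk), Nat.cast_zero, zero_mul]

theorem unitPow_natCast (u : ℂ_[p]) (m : ℕ) : unitPow u m = u ^ m := by
  rw [unitPow, tsum_binom_natCast_mul]
  conv_rhs => rw [← sub_add_cancel u 1, add_pow]
  exact Finset.sum_congr rfl fun k _ => by rw [one_pow, mul_one, mul_comm]

theorem norm_sub_one_pow_le {u : ℂ_[p]} (hu : ‖u - 1‖ ≤ (p : ℝ)⁻¹) (k : ℕ) :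
    ‖(u - 1) ^ k‖ ≤ ((p : ℝ)⁻¹) ^ k := by
  rw [norm_pow]
  exact pow_le_pow_left₀ (norm_nonneg _) hu k

theorem isPowerSeriesOn_unitPow (hp : p ≠ 2) {u : ℂ_[p]} (hu : ‖u - 1‖ ≤ (p : ℝ)⁻¹) :
    IsPowerSeriesOn (discRadius p) (unitPow u) :=
  isPowerSeriesOn_tsum_binom_mul hp (norm_sub_one_pow_le hu)

/-- Clear for positive integer exponents; the identity principle extends it to the disc. -/
theorem unitPow_mul (hp : p ≠ 2) {u v : ℂ_[p]} (hu : ‖u - 1‖ ≤ (p : ℝ)⁻¹)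
    (hv : ‖v - 1‖ ≤ (p : ℝ)⁻¹) {s : ℂ_[p]} (hs : ‖s‖ < discRadius p) :
    unitPow (u * v) s = unitPow u s * unitPow v s := by
  have hR := one_lt_discRadius hp
  have huv : ‖u * v - 1‖ ≤ (p : ℝ)⁻¹ := by
    have h1 : ‖u‖ ≤ 1 := by
      have := IsUltrametricDist.norm_add_le_max (u - 1) 1
      rw [sub_add_cancel, norm_one] at this
      refine this.trans (max_le (hu.trans ?_) le_rfl)
      exact inv_le_one_of_one_le₀ (by exact_mod_cast (Fact.out : p.Prime).one_le)
    rw [show u * v - 1 = u * (v - 1) + (u - 1) by ring]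
    refine (IsUltrametricDist.norm_add_le_max _ _).trans (max_le ?_ hu)
    rw [norm_mul]
    exact (mul_le_of_le_one_left (norm_nonneg _) h1).trans hv
  refine IsPowerSeriesOn.eq_of_eq_natCast (f := unitPow (u * v))
    (g := fun s => unitPow u s * unitPow v s) (by linarith) (isPowerSeriesOn_unitPow hp huv)
    ((isPowerSeriesOn_unitPow hp hu).mul (isPowerSeriesOn_unitPow hp hv)) (fun n _ => ?_) hs
  simp only [unitPow_natCast, mul_pow]

end Binomial

end PadicEulerL
namespace PadicEulerL

/-! ### The `p`-adic `l`-function -/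

section PadicL

open Finset

variable {p : ℕ} [Fact p.Prime] {d : ℕ}

theorem innerTerm_eq (F a : ℕ) (s : ℂ_[p]) (k : ℕ) :
    innerTerm F a s k =
      binom (-s) k * (((F : ℂ_[p]) / (a : ℂ_[p])) ^ k * (eulerNumber k : ℂ_[p])) :=
  mul_assoc _ _ _

theorem norm_div_pow_mul_le {F a : ℕ} (hF : p ∣ F) (ha : ¬ p ∣ a) {e : ℂ_[p]} (he : ‖e‖ ≤ 1)
    (k : ℕ) : ‖((F : ℂ_[p]) / (a : ℂ_[p])) ^ k * e‖ ≤ ((p : ℝ)⁻¹) ^ k := by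
  rw [norm_mul, norm_pow]
  exact (mul_le_of_le_one_right (by positivity) he).trans
    (pow_le_pow_left₀ (norm_nonneg _) (norm_div_natCast_le hF ha) k)

theorem summable_innerTerm (hp : p ≠ 2) {F a : ℕ} (hF : p ∣ F) (ha : ¬ p ∣ a) {s : ℂ_[p]}
    (hs : s ∈ disc p) : Summable fun k => innerTerm F a s k := by
  simp only [innerTerm_eq]
  exact summable_binom_mul hp
    (fun k => norm_div_pow_mul_le hF ha (norm_eulerNumber_le_one hp k) k) (by rwa [norm_neg])

theorem isPowerSeriesOn_padicL (hp : p ≠ 2) (χ : DirichletCharacter ℂ_[p] d) {F : ℕ}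
    (hF : p ∣ F) : IsPowerSeriesOn (discRadius p) (padicL χ F) := by
  refine IsPowerSeriesOn.sum _ fun a ha => ?_
  have hpa : ¬ p ∣ a := (mem_filter.mp ha).2
  refine ((IsPowerSeriesOn.const _).mul (isPowerSeriesOn_unitPow hp
    (norm_angle_sub_one_le (isUnit_natCast hpa))).comp_neg).mul ?_
  simp only [innerTerm_eq]
  exact (isPowerSeriesOn_tsum_binom_mul hp
    fun k => norm_div_pow_mul_le hF hpa (norm_eulerNumber_le_one hp k) k).comp_neg

theorem padicL_neg_natCast [NeZero d] {χ : DirichletCharacter ℂ_[p] d} (hχ : χ.IsPrimitive)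
    {F : ℕ} (hF : Odd F) (hpF : p ∣ F) (hdF : d ∣ F) (n : ℕ) :
    padicL χ F (-(n : ℂ_[p])) =
      genEulerNumber (twist χ n) n -
        (p : ℂ_[p]) ^ n * twist χ n (p : ZMod _) * genEulerNumber (twist χ n) n := by
  rw [← sum_filter_not_dvd_eulerSum Fact.out (twist χ n)
    ((conductor_twist_dvd_lcm χ n).trans (Nat.lcm_dvd hdF hpF)) hpF hF, padicL]
  refine sum_congr rfl fun a ha => ?_
  have hpa : ¬ p ∣ a := (mem_filter.mp ha).2
  have ha0 : (a : ℂ_[p]) ≠ 0 := by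
    rw [← norm_ne_zero_iff, norm_natCast_eq_one hpa]
    exact one_ne_zero
  have hω := omega_ne_zero (isUnit_natCast hpa)
  have hser : (a : ℂ_[p]) ^ n * ∑' k, innerTerm F a (-(n : ℂ_[p])) k =
      eulerSum n (a : ℂ_[p]) (F : ℂ_[p]) := by
    simp only [innerTerm_eq, neg_neg]
    rw [tsum_binom_natCast_mul, mul_sum, eulerSum]
    refine sum_congr rfl fun k hk => ?_
    rw [pow_sub₀ _ ha0 (Nat.lt_succ_iff.mp (mem_range.mp hk)), div_pow]
    field_simp
  rw [neg_neg, unitPow_natCast, ← hser, ← twist_natCast_mul_omega_zpow χ hχ n hpa, angle, div_pow,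
    map_natCast (toCp p), zpow_natCast]
  field_simp

/-- The values at negative integers do not involve the modulus; the identity principle applies after
`s ↦ -s`. -/
theorem padicL_eq_padicL (hp : p ≠ 2) [NeZero d] {χ : DirichletCharacter ℂ_[p] d}
    (hχ : χ.IsPrimitive) {F F' : ℕ} (hF : Odd F) (hpF : p ∣ F) (hdF : d ∣ F) (hF' : Odd F')
    (hpF' : p ∣ F') (hdF' : d ∣ F') {s : ℂ_[p]} (hs : s ∈ disc p) :
    padicL χ F s = padicL χ F' s := by
  have hR := one_lt_discRadius hp
  have h := IsPowerSeriesOn.eq_of_eq_natCast (by linarith) (isPowerSeriesOn_padicL hp χ hpF).comp_neg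
    (isPowerSeriesOn_padicL hp χ hpF').comp_neg
    (fun n _ => by
      rw [padicL_neg_natCast hχ hF hpF hdF, padicL_neg_natCast hχ hF' hpF' hdF'])
    (s := -s) (by rwa [norm_neg])
  simpa only [neg_neg] using h

end PadicL

/-! ### The integral -/

section Integral

open Finset

variable {p : ℕ} [Fact p.Prime] {d : ℕ}

omit [Fact p.Prime] in
theorem XSpace.natCast_apply (x N : ℕ) : (x : XSpace p d).1 N = (x : ZMod (d * p ^ N)) :=
  map_natCast ((Pi.evalRingHom (fun N : ℕ => ZMod (d * p ^ N)) N).comp (XSpace p d).subtype) x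

theorem XSpace.natCast_mem_star_iff (hd : 0 < d) (x : ℕ) :
    (x : XSpace p d) ∈ XSpace.star p d ↔ ¬ p ∣ x := by
  have hp : p.Prime := Fact.out
  simp only [XSpace.star, Set.mem_iUnion, Set.mem_ofPred_eq, XSpace.coset, XSpace.natCast_apply,
    exists_prop]
  rw [pow_one]
  constructor
  · rintro ⟨a, ⟨-, -, ha⟩, hxa⟩ hx
    rw [ZMod.natCast_eq_natCast_iff] at hxa
    have h := (hxa.of_mul_left d).dvd_iff dvd_rfl
    exact (hp.coprime_iff_not_dvd.mp ha.symm) (h.mp hx)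
  · intro hx
    have hmod : ¬ p ∣ x % (d * p) := by
      rwa [← Nat.dvd_mod_iff (dvd_mul_left p d)] at hx
    refine ⟨x % (d * p), ⟨Nat.pos_of_ne_zero fun h => hmod (h ▸ dvd_zero p),
      Nat.mod_lt _ (Nat.mul_pos hd hp.pos), (hp.coprime_iff_not_dvd.mpr hmod).symm⟩, ?_⟩
    rw [ZMod.natCast_mod]

theorem evalChar_twist_natCast (χ : DirichletCharacter ℂ_[p] d) (n : ℤ) (x : ℕ) :
    XSpace.evalChar (twist χ n) (x : XSpace p d) = twist χ n (x : ZMod _) := by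
  rw [XSpace.evalChar, XSpace.natCast_apply, ZMod.cast_natCast]
  rw [pow_one]
  exact (conductor_twist_dvd_lcm χ n).trans (Nat.lcm_dvd_mul d p)

theorem evalChar_mul_branchPow_natCast [NeZero d] {χ : DirichletCharacter ℂ_[p] d}
    (hχ : χ.IsPrimitive) (n : ℤ) (s : ℂ_[p]) {x : ℕ} (hx : ¬ p ∣ x) :
    XSpace.evalChar (twist χ n) (x : XSpace p d) *
        branchPow n (XSpace.toPadicInt p d (x : XSpace p d)) s =
      χ (x : ZMod d) * unitPow (angle (x : ℤ_[p])) s := by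
  rw [evalChar_twist_natCast, map_natCast (XSpace.toPadicInt p d), branchPow, ← mul_assoc,
    twist_natCast_mul_omega_zpow χ hχ n hx]

theorem evalChar_mul_pow_natCast [NeZero d] {χ : DirichletCharacter ℂ_[p] d}
    (hχ : χ.IsPrimitive) (n : ℕ) {x : ℕ} (hx : ¬ p ∣ x) :
    XSpace.evalChar (twist χ n) (x : XSpace p d) *
        toCp p (XSpace.toPadicInt p d (x : XSpace p d)) ^ n =
      χ (x : ZMod d) * unitPow (angle (x : ℤ_[p])) n := by
  rw [evalChar_twist_natCast, map_natCast (XSpace.toPadicInt p d),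
    map_natCast (toCp p), ← twist_natCast_mul_omega_zpow χ hχ n hx, unitPow_natCast, angle, map_natCast (toCp p),
    zpow_natCast, div_pow, mul_assoc,
    mul_div_cancel₀ _ (pow_ne_zero n (omega_ne_zero (isUnit_natCast hx)))]

theorem unitPow_angle_natCast_add (hp : p ≠ 2) {F a : ℕ} (hF : p ∣ F) (ha : ¬ p ∣ a) (j : ℕ)
    {s : ℂ_[p]} (hs : ‖s‖ < discRadius p) :
    unitPow (angle ((a + F * j : ℕ) : ℤ_[p])) s = unitPow (angle (a : ℤ_[p])) s *
      ∑' k, binom s k * (((F : ℂ_[p]) / (a : ℂ_[p])) ^ k * (j : ℂ_[p]) ^ k) := by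
  have h : ‖1 + ((F * j : ℕ) : ℂ_[p]) / (a : ℂ_[p]) - 1‖ ≤ (p : ℝ)⁻¹ := by
    rw [add_sub_cancel_left]
    exact norm_div_natCast_le (hF.mul_right j) ha
  rw [angle_natCast_add ha (hF.mul_right j),
    unitPow_mul hp (norm_angle_sub_one_le (isUnit_natCast ha)) h hs]
  congr 1
  refine tsum_congr fun k => ?_
  rw [add_sub_cancel_left, ← mul_pow]
  push_cast
  ring

/-- The factors `binom s k * z ^ k` are bounded and the power-sum error is at most `|p ^ N|` for
every `k`, so the ultrametric inequality bounds the whole series of errors by `C |p ^ N|`. -/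
theorem tendsto_alternating_sum_tsum_binom (hp : p ≠ 2) {F a : ℕ} (hF : p ∣ F) (ha : ¬ p ∣ a)
    {s : ℂ_[p]} (hs : ‖s‖ < discRadius p) :
    Tendsto (fun N : ℕ => ∑ j ∈ range (p ^ N), (-1) ^ j *
        ∑' k, binom s k * (((F : ℂ_[p]) / (a : ℂ_[p])) ^ k * (j : ℂ_[p]) ^ k)) atTop
      (𝓝 (∑' k, binom s k * (((F : ℂ_[p]) / (a : ℂ_[p])) ^ k * (eulerNumber k : ℂ_[p])))) := by
  have hpodd : Odd p := (Fact.out : p.Prime).odd_of_ne_two hp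
  set z := (F : ℂ_[p]) / (a : ℂ_[p])
  have hsum : ∀ e : ℕ → ℂ_[p], (∀ k, ‖e k‖ ≤ 1) → Summable fun k => binom s k * (z ^ k * e k) :=
    fun e he => summable_binom_mul hp (fun k => norm_div_pow_mul_le hF ha (he k) k) hs
  have hpow : ∀ j k : ℕ, ‖(j : ℂ_[p]) ^ k‖ ≤ 1 := fun j k => by
    rw [norm_pow]
    exact pow_le_one₀ (norm_nonneg _) (norm_natCast_le_one j)
  obtain ⟨C, hC⟩ : ∃ C, ∀ k, ‖binom s k * z ^ k‖ ≤ C := by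
    have h := (hsum (fun _ => 1) fun _ => by simp).tendsto_atTop_zero
    simp only [mul_one] at h
    obtain ⟨C, hC⟩ := h.norm.bddAbove_range
    exact ⟨C, fun k => hC ⟨k, rfl⟩⟩
  have hC0 : 0 ≤ C := (norm_nonneg _).trans (hC 0)
  have hMtend : Tendsto (fun N : ℕ => C * ‖((p ^ N : ℕ) : ℂ_[p])‖) atTop (𝓝 0) := by
    have h := (IsPowerSeriesOn.tendsto_prime_pow (p := p)).mono_right nhdsWithin_le_nhds
    simpa using h.norm.const_mul C
  rw [tendsto_iff_norm_sub_tendsto_zero]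
  refine squeeze_zero (fun N => norm_nonneg _) (fun N => ?_) hMtend
  have hE := hsum (fun k => (eulerNumber k : ℂ_[p])) (norm_eulerNumber_le_one hp)
  have h1 : ∑ j ∈ range (p ^ N), (-1) ^ j * ∑' k, binom s k * (z ^ k * (j : ℂ_[p]) ^ k) -
      ∑' k, binom s k * (z ^ k * (eulerNumber k : ℂ_[p])) =
      ∑' k, binom s k * z ^ k *
        ((∑ j ∈ range (p ^ N), (-1) ^ j * (j : ℂ_[p]) ^ k) - (eulerNumber k : ℂ_[p])) := by
    have h2 : HasSum (fun k => ∑ j ∈ range (p ^ N), (-1) ^ j *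
        (binom s k * (z ^ k * (j : ℂ_[p]) ^ k)))
        (∑ j ∈ range (p ^ N), (-1) ^ j * ∑' k, binom s k * (z ^ k * (j : ℂ_[p]) ^ k)) :=
      hasSum_sum fun j _ => (hsum (fun k => (j : ℂ_[p]) ^ k) (hpow j)).hasSum.mul_left _
    rw [← (h2.sub hE.hasSum).tsum_eq]
    refine tsum_congr fun k => ?_
    rw [mul_sub, mul_sum, mul_assoc]
    congr 1
    exact sum_congr rfl fun j _ => by ring
  rw [h1]
  refine IsUltrametricDist.norm_tsum_le_of_forall_le_of_nonneg (by positivity) fun k => ?_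
  rw [norm_mul]
  exact mul_le_mul (hC k) (norm_alternating_sum_pow_sub_le hp hpodd.pow k) (norm_nonneg _) hC0

theorem sum_range_indicator_star (hd : Odd d) (hp : p ≠ 2) {f : XSpace p d → ℂ_[p]}
    {g : ℕ → ℂ_[p]} (hfg : ∀ x : ℕ, ¬ p ∣ x → f (x : XSpace p d) = g x) (N : ℕ) :
    ∑ x ∈ range (d * p ^ (N + 1)), (XSpace.star p d).indicator f (x : XSpace p d) * (-1) ^ x =
      ∑ a ∈ (Icc 1 (d * p)).filter (fun a => ¬ p ∣ a),
        ∑ j ∈ range (p ^ N), (-1) ^ a * (-1) ^ j * g (a + d * p * j) := by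
  have hpodd : Odd p := (Fact.out : p.Prime).odd_of_ne_two hp
  have hpos : 0 < d * p ^ (N + 1) := Nat.mul_pos hd.pos (pow_pos hpodd.pos _)
  have hval : ∀ x : ℕ, (XSpace.star p d).indicator f (x : XSpace p d) * (-1) ^ x =
      if ¬ p ∣ x then (-1) ^ x * g x else 0 := by
    intro x
    by_cases hx : p ∣ x
    · rw [Set.indicator_of_notMem (by rwa [XSpace.natCast_mem_star_iff hd.pos, not_not])]
      simp [hx]
    · rw [Set.indicator_of_mem ((XSpace.natCast_mem_star_iff hd.pos x).mpr hx), hfg x hx, if_pos hx,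
        mul_comm]
  have hpN : p ∣ d * p ^ (N + 1) := (dvd_pow_self p N.succ_ne_zero).mul_left d
  -- Both endpoints `0` and `d p ^ (N + 1)` are multiples of `p` and contribute nothing, so the
  -- range can be shifted to match `1 ≤ a ≤ d p`.
  have hIcc : ∀ h : ℕ → ℂ_[p], h 0 = 0 → h (d * p ^ (N + 1)) = 0 →
      ∑ x ∈ range (d * p ^ (N + 1)), h x = ∑ x ∈ Icc 1 (d * p ^ (N + 1)), h x := by
    intro h h0 hM
    rw [← add_zero (∑ x ∈ range _, h x), ← hM, ← sum_range_succ, eq_comm]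
    refine sum_subset (fun x hx => ?_) fun x hx hx' => ?_
    · rw [mem_Icc] at hx
      rw [mem_range]
      omega
    · rw [mem_range] at hx
      rw [mem_Icc] at hx'
      rw [show x = 0 by omega, h0]
  rw [sum_congr rfl fun x _ => hval x, hIcc _ (by simp) (by simp [hpN]),
    show d * p ^ (N + 1) = d * p * p ^ N by ring, sum_Icc_one_mul, sum_comm, sum_filter]
  refine sum_congr rfl fun a _ => ?_
  have hdvd : ∀ j : ℕ, p ∣ a + d * p * j ↔ p ∣ a := fun j =>
    (Nat.dvd_add_left (Dvd.intro_left d rfl |>.mul_right j))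
  simp only [hdvd]
  by_cases ha : p ∣ a
  · simp [ha]
  · simp only [ha, not_false_eq_true, if_true]
    refine sum_congr rfl fun j _ => ?_
    rw [pow_add, pow_mul _ (d * p), (hd.mul hpodd).neg_one_pow]

theorem hasFermionicIntegralOn_star (hp : p ≠ 2) (hd : Odd d) {χ : DirichletCharacter ℂ_[p] d}
    {s : ℂ_[p]} (hs : s ∈ disc p) {f : XSpace p d → ℂ_[p]}
    (hf : ∀ x : ℕ, ¬ p ∣ x →
      f (x : XSpace p d) = χ (x : ZMod d) * unitPow (angle (x : ℤ_[p])) (-s)) :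
    HasFermionicIntegralOn (XSpace.star p d) f (padicL χ (d * p) s) := by
  have hs' : ‖-s‖ < discRadius p := by rwa [norm_neg]
  -- Dropping `N = 0` makes `d p ^ N` a multiple of `d p`, as the splitting `x = a + d p j`
  -- requires.
  rw [HasFermionicIntegralOn, HasFermionicIntegral, ← tendsto_add_atTop_iff_nat 1]
  simp only [sum_range_indicator_star hd hp hf]
  refine tendsto_finsetSum _ fun a ha => ?_
  have hpa : ¬ p ∣ a := (mem_filter.mp ha).2
  have hterm : ∀ j : ℕ, (-1) ^ a * (-1) ^ j * (χ ((a + d * p * j : ℕ) : ZMod d) *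
      unitPow (angle ((a + d * p * j : ℕ) : ℤ_[p])) (-s)) =
      (-1) ^ a * χ (a : ZMod d) * unitPow (angle (a : ℤ_[p])) (-s) * ((-1) ^ j *
        ∑' k, binom (-s) k * ((((d * p : ℕ) : ℂ_[p]) / (a : ℂ_[p])) ^ k * (j : ℂ_[p]) ^ k)) := by
    intro j
    have h1 : ((a + d * p * j : ℕ) : ZMod d) = a := by simp
    rw [h1, unitPow_angle_natCast_add hp (dvd_mul_left p d) hpa j hs']
    ring
  simp only [hterm, ← mul_sum, innerTerm_eq]
  exact (tendsto_alternating_sum_tsum_binom hp (dvd_mul_left p d) hpa hs').const_mul _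

theorem neg_natCast_mem_disc (hp : p ≠ 2) (n : ℕ) : -(n : ℂ_[p]) ∈ disc p := by
  change ‖_‖ < _
  rw [norm_neg]
  exact (norm_natCast_le_one n).trans_lt (one_lt_discRadius hp)

end Integral

end PadicEulerL

open PadicEulerL

theorem corollary8 (p : ℕ) [Fact p.Prime] (hp : p ≠ 2) (d : ℕ) (hd : Odd d)
    (χ : DirichletCharacter ℂ_[p] d) (hχ : χ.IsPrimitive)
    (F : ℕ) (hF : Odd F) (hpF : p ∣ F) (hdF : d ∣ F) :
    -- (a) all series converge on the disc, and `l_p(s, χ)` is given there by one power series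
    ((∀ s ∈ disc p,
        (∀ x : ℤ_[p], IsUnit x → Summable fun k : ℕ => binom (-s) k * (angle x - 1) ^ k) ∧
        (∀ a ∈ Finset.Icc 1 F, ¬ p ∣ a → Summable fun k : ℕ => innerTerm F a s k)) ∧
      ∃ P : FormalMultilinearSeries ℂ_[p] ℂ_[p] ℂ_[p],
        HasFPowerSeriesOnBall (padicL χ F) P 0 (ENNReal.ofReal (discRadius p))) ∧
    -- (b) values at negative integers
    (∀ n : ℕ, 0 < n →
      padicL χ F (-(n : ℂ_[p])) =
        genEulerNumber (twist χ n) n -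
          (p : ℂ_[p]) ^ n * twist χ n (p : ZMod _) * genEulerNumber (twist χ n) n) ∧
    -- (c) the integral representation
    (∀ n : ℤ, ∀ s ∈ disc p,
      HasFermionicIntegralOn (XSpace.star p d)
        (fun x => XSpace.evalChar (twist χ n) x * branchPow n (XSpace.toPadicInt p d x) (-s))
        (padicL χ F s)) ∧
    (∀ n : ℕ, 0 < n →
      HasFermionicIntegralOn (XSpace.star p d)
        (fun x => XSpace.evalChar (twist χ n) x * toCp p (XSpace.toPadicInt p d x) ^ n)
        (padicL χ F (-(n : ℂ_[p])))) := by
  have : NeZero d := ⟨hd.pos.ne'⟩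
  have hpodd : Odd p := (Fact.out : p.Prime).odd_of_ne_two hp
  -- The Riemann sums over `X` produce the modulus `d p`; this returns to the given `F`.
  have hLF : ∀ s ∈ disc p, padicL χ F s = padicL χ (d * p) s := fun s hs =>
    padicL_eq_padicL hp hχ hF hpF hdF (hd.mul hpodd) (dvd_mul_left p d) (dvd_mul_right d p) hs
  refine ⟨⟨fun s hs => ⟨fun x hx => ?_, fun a _ ha => summable_innerTerm hp hpF ha hs⟩, ?_⟩,
    fun n _ => padicL_neg_natCast hχ hF hpF hdF n, fun n s hs => ?_, fun n _ => ?_⟩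
  · exact summable_binom_mul hp (norm_sub_one_pow_le (norm_angle_sub_one_le hx))
      (by rwa [norm_neg])
  · obtain ⟨a, ha, ha'⟩ := isPowerSeriesOn_padicL hp χ hpF
    exact ⟨_, IsPowerSeriesOn.hasFPowerSeriesOnBall
      (zero_lt_one.trans (one_lt_discRadius hp)) ha ha'⟩
  · rw [hLF s hs]
    exact hasFermionicIntegralOn_star hp hd hs fun x hx =>
      evalChar_mul_branchPow_natCast hχ n (-s) hx
  · rw [hLF _ (neg_natCast_mem_disc hp n)]
    refine hasFermionicIntegralOn_star hp hd (neg_natCast_mem_disc hp n) fun x hx => ?_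
    rw [neg_neg]
    exact evalChar_mul_pow_natCast hχ n hx
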